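/- Let $V=\mathbb{C}^\ell$, $S=\mathbb{C}[x_1,\dots,x_\ell]$, and let $\Omega^p_V$ be the $S$-module of polynomial $p$-forms on $V$. A multiarrangement $(\mathcal{A},m)$ in $V$ consists of finitely many distinct hyperplanes $H_1,\dots,H_n$ through the origin, $H_i=\ker\alpha_i$ with $0\neq\alpha_i\in V^*$, and a map $m:\mathcal{A}=\{H_1,\dots,H_n\}\to\mathbb{Z}_{\ge 0}$. Put $Q=\prod_{i=1}^n\alpha_i^{m(H_i)}$ and, for $p\ge 0$, $$\Omega^p(\mathcal{A},m)=\left\{\omega\in\tfrac1Q\Omega^p_V \;\middle|\; d\alpha_i\wedge\omega\text{ has no pole along }H_i\text{ for all } i\right\},$$ an $S$-module graded by $\deg(\varphi\,dx_{j_1}\wedge\dots\wedge dx_{j_p})=\deg\varphi$ for homogeneous rational functions $\varphi$. Here a rational form has no pole along $H_i$ if its coefficients lie in the local ring $S_{(\alpha_i)}$. Let $(\mathcal{A}_1,m_1)$ and $(\mathcal{A}_2,m_2)$ be multiarrangements in $V$. If $\Omega^1(\mathcal{A}_1,m_1)\cong\Omega^1(\mathcal{A}_2,m_2)$ as graded $S$-modules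 (isomorphisms preserving degree), then $\Omega^p(\mathcal{A}_1,m_1)\cong\Omega^p(\mathcal{A}_2,m_2)$ as graded $S$-modules for every $p\ge 0$. Likewise, if $\Omega^1(\mathcal{A}_1,m_1)\cong\Omega^1(\mathcal{A}_2,m_2)$ as $S$-modules (ignoring the grading), then $\Omega^p(\mathcal{A}_1,m_1)\cong\Omega^p(\mathcal{A}_2,m_2)$ as $S$-modules for every $p\ge 0$. -/

import Mathlib

open MvPolynomial

noncomputable section

namespace LogForms

/-- The coordinate ring `S = ℂ[x₁, …, x_ℓ]` of `V = ℂ^ℓ`. -/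
abbrev S (ℓ : ℕ) : Type := MvPolynomial (Fin ℓ) ℂ

/-- The field of rational functions on `V = ℂ^ℓ`. -/
abbrev K (ℓ : ℕ) : Type := FractionRing (S ℓ)

/-- The exterior algebra of rational differential forms on `V = ℂ^ℓ`, that is, the exterior
algebra over `K` of the Kähler differentials of `K` over `ℂ`; the product is the wedge product. -/
abbrev RatForms (ℓ : ℕ) : Type := ExteriorAlgebra (K ℓ) (Ω[K ℓ⁄ℂ])

/-- The differential of a polynomial, as a rational `1`-form. -/
def d {ℓ : ℕ} (f : S ℓ) : Ω[K ℓ⁄ℂ] :=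
  KaehlerDifferential.D ℂ (K ℓ) (algebraMap (S ℓ) (K ℓ) f)

/-- The `S`-module `Ω^p_V` of regular (polynomial) `p`-forms on `V`, inside the rational forms:
the `S`-span of all `df₁ ∧ ⋯ ∧ df_p` with `f₁, …, f_p ∈ S`. -/
def regularForms (ℓ p : ℕ) : Submodule (S ℓ) (RatForms ℓ) :=
  Submodule.span (S ℓ)
    (Set.range fun f : Fin p → S ℓ => ExteriorAlgebra.ιMulti (K ℓ) p fun k => d (f k))

/-- A linear form `α ∈ V^*`, as a polynomial of degree one. -/
def linPoly {ℓ : ℕ} (α : Module.Dual ℂ (Fin ℓ → ℂ)) : S ℓ :=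
  ∑ j, C (α (Pi.single j 1)) * X j

/-- A (central) multiarrangement in `V = ℂ^ℓ`: finitely many pairwise distinct hyperplanes
`H_i = ker α_i` through the origin, with fixed defining linear forms `α_i`, and a multiplicity
`m(H_i) ∈ ℤ_{≥ 0}` for each of them. -/
structure Multiarrangement (ℓ : ℕ) where
  /-- the number of hyperplanes -/
  n : ℕ
  /-- the defining linear forms -/
  form : Fin n → Module.Dual ℂ (Fin ℓ → ℂ)
  form_ne_zero : ∀ i, form i ≠ 0
  ker_injective : Function.Injective fun i => LinearMap.ker (form i)
  /-- the multiplicities -/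
  mult : Fin n → ℕ

lemma coeff_linPoly {ℓ : ℕ} (α : Module.Dual ℂ (Fin ℓ → ℂ)) (j : Fin ℓ) :
    (linPoly α).coeff (Finsupp.single j 1) = α (Pi.single j 1) := by
  classical
  simp [linPoly, coeff_sum, coeff_C_mul, coeff_X, Finsupp.single_left_inj]

lemma linPoly_isHomogeneous {ℓ : ℕ} (α : Module.Dual ℂ (Fin ℓ → ℂ)) :
    (linPoly α).IsHomogeneous 1 :=
  IsHomogeneous.sum _ _ _ fun j _ => by simpa using (isHomogeneous_C _ _).mul (isHomogeneous_X ℂ j)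

lemma linPoly_ne_zero {ℓ : ℕ} {α : Module.Dual ℂ (Fin ℓ → ℂ)} (h : α ≠ 0) : linPoly α ≠ 0 := by
  intro h0
  apply h
  refine LinearMap.pi_ext' fun j => LinearMap.ext_ring ?_
  have := coeff_linPoly α j
  simpa [h0] using this.symm

lemma prime_linPoly {ℓ : ℕ} {α : Module.Dual ℂ (Fin ℓ → ℂ)} (h : α ≠ 0) : Prime (linPoly α) := by
  have h1 : (linPoly α).totalDegree = 1 :=
    (linPoly_isHomogeneous α).totalDegree (linPoly_ne_zero h)
  refine (irreducible_of_totalDegree_eq_one h1 fun x hx => ?_).prime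
  have hx0 : x ≠ 0 := by
    rintro rfl
    apply linPoly_ne_zero h
    ext c
    simpa using hx c
  exact isUnit_iff_ne_zero.mpr hx0

/-- The rational `p`-forms without pole along the hyperplane `α = 0`: those which become regular
after multiplication by some polynomial that does not vanish identically on the hyperplane,
i.e. those with coefficients in the local ring `S_{(α)}`. -/
def NoPole {ℓ : ℕ} (α : Module.Dual ℂ (Fin ℓ → ℂ)) (p : ℕ) (η : RatForms ℓ) : Prop :=
  ∃ g : S ℓ, ¬ linPoly α ∣ g ∧ g • η ∈ regularForms ℓ p

namespace Multiarrangement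

variable {ℓ : ℕ}

/-- The defining polynomial `Q(A, m) = ∏ α_i ^ m(H_i)`. -/
def Q (A : Multiarrangement ℓ) : S ℓ := ∏ i, linPoly (A.form i) ^ A.mult i

/-- The module `Ω^p(A, m)` of logarithmic `p`-forms: the rational `p`-forms `ω ∈ (1/Q) Ω^p_V` such
that `dα_i ∧ ω` has no pole along `H_i`, for all `i`. -/
def logForms (A : Multiarrangement ℓ) (p : ℕ) : Submodule (S ℓ) (RatForms ℓ) where
  carrier := {ω | A.Q • ω ∈ regularForms ℓ p ∧
    ∀ i, NoPole (A.form i) (p + 1) (ExteriorAlgebra.ι (K ℓ) (d (linPoly (A.form i))) * ω)}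
  zero_mem' := ⟨by simp, fun i => ⟨1, fun h =>
    (prime_linPoly (A.form_ne_zero i)).not_isUnit (isUnit_of_dvd_one h), by simp⟩⟩
  add_mem' := by
    rintro ω η ⟨h1, h2⟩ ⟨k1, k2⟩
    refine ⟨by rw [smul_add]; exact add_mem h1 k1, fun i => ?_⟩
    obtain ⟨g, hg, hω⟩ := h2 i
    obtain ⟨g', hg', hη⟩ := k2 i
    refine ⟨g * g', fun h => ((prime_linPoly (A.form_ne_zero i)).dvd_or_dvd h).elim hg hg', ?_⟩
    rw [mul_add, smul_add]
    refine add_mem ?_ ?_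
    · rw [mul_comm, mul_smul]
      exact Submodule.smul_mem _ _ hω
    · rw [mul_smul]
      exact Submodule.smul_mem _ _ hη
  smul_mem' := by
    rintro c ω ⟨h1, h2⟩
    refine ⟨by rw [smul_comm]; exact Submodule.smul_mem _ _ h1, fun i => ?_⟩
    obtain ⟨g, hg, hω⟩ := h2 i
    refine ⟨g, hg, ?_⟩
    rw [mul_smul_comm, smul_comm]
    exact Submodule.smul_mem _ _ hω

end Multiarrangement

/-- A rational function is homogeneous of degree `e ∈ ℤ` if it is a quotient `a / b` of homogeneous
polynomials with `deg a - deg b = e` (zero is homogeneous of every degree). -/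
def IsHomogeneousRat {ℓ : ℕ} (e : ℤ) (φ : K ℓ) : Prop :=
  ∃ (r s : ℕ) (a b : S ℓ), a.IsHomogeneous r ∧ b.IsHomogeneous s ∧ b ≠ 0 ∧ (r : ℤ) - s = e ∧
    φ = algebraMap (S ℓ) (K ℓ) a / algebraMap (S ℓ) (K ℓ) b

/-- The rational `p`-forms homogeneous of (polynomial) degree `e`: the sums of forms
`φ dx_{j₁} ∧ ⋯ ∧ dx_{j_p}` with `φ` homogeneous of degree `e`. -/
def homogeneousForms (ℓ p : ℕ) (e : ℤ) : Submodule ℂ (RatForms ℓ) :=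
  Submodule.span ℂ {ω | ∃ (φ : K ℓ) (j : Fin p → Fin ℓ), IsHomogeneousRat e φ ∧
    ω = φ • ExteriorAlgebra.ιMulti (K ℓ) p fun k => d (X (j k))}

/-- `Ω^p(A₁, m₁) ≅ Ω^p(A₂, m₂)` as `S`-modules. -/
def LogFormsIso {ℓ : ℕ} (A₁ A₂ : Multiarrangement ℓ) (p : ℕ) : Prop :=
  Nonempty (A₁.logForms p ≃ₗ[S ℓ] A₂.logForms p)

/-- `Ω^p(A₁, m₁) ≅ Ω^p(A₂, m₂)` as graded `S`-modules: there is an `S`-linear isomorphism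
that maps the forms of each degree onto the forms of the same degree. -/
def LogFormsGradedIso {ℓ : ℕ} (A₁ A₂ : Multiarrangement ℓ) (p : ℕ) : Prop :=
  ∃ Φ : A₁.logForms p ≃ₗ[S ℓ] A₂.logForms p, ∀ (e : ℤ) (ω : A₁.logForms p),
    (ω : RatForms ℓ) ∈ homogeneousForms ℓ p e ↔ (Φ ω : RatForms ℓ) ∈ homogeneousForms ℓ p e

end LogForms

end

noncomputable section

namespace LogForms

open KaehlerDifferential

variable {ℓ : ℕ}

/-! Inside the algebra of rational forms, `Ω^p(A, m)` is determined by `Ω^1(A, m)`: a form is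
logarithmic exactly when, locally at every prime of `S`, it lies in the `p`-th power of `Ω^1(A, m)`
(`mem_logForms_iff`). Away from `Q` both sides are locally the regular forms. At `H_i` both are
locally the `p`-th power of `U i`, spanned by the regular `1`-forms and `dα_i / α_i ^ m(H_i)`
(`logForms_le_locAt_U`, `of_mem_U_pow`). Regularity at all primes gives regularity
(`mem_of_forall_prime`), so the local comparison suffices. Since `Ω^1(A, m)` lies between the
regular `1`-forms and `1/Q` times them, an isomorphism of these modules extends `K`-linearly to
`1`-forms, hence to an automorphism of the exterior algebra (`exists_algEquiv`). It preserves powers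
and local membership, so it matches logarithmic `p`-forms for all `p`. In the graded case it sends
each `dx_j` to a form of degree `0`, so it preserves degree. -/

/-! ### Regular forms and contractions. -/

/-- The basis `dx₁, …, dx_ℓ` of the rational `1`-forms. -/
def dxBasis (ℓ : ℕ) : Module.Basis (Fin ℓ) (K ℓ) (Ω[K ℓ⁄ℂ]) :=
  haveI := Algebra.FormallyEtale.of_isLocalization (R := S ℓ) (Rₘ := K ℓ) (nonZeroDivisors (S ℓ))
  ((mvPolynomialBasis ℂ (Fin ℓ)).baseChange (K ℓ)).map
    (tensorKaehlerEquivOfFormallyEtale ℂ (S ℓ) (K ℓ))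

lemma dxBasis_apply (j : Fin ℓ) : dxBasis ℓ j = d (X j) := by
  simp [dxBasis, mvPolynomialBasis_apply, d]

/-- The differential `df` of a polynomial `f`, in the algebra of rational forms. -/
abbrev δ (f : S ℓ) : RatForms ℓ := ExteriorAlgebra.ι (K ℓ) (d f)

lemma d_add (f g : S ℓ) : d (f + g) = d f + d g := by simp [d]

lemma d_mul (f g : S ℓ) : d (f * g) = f • d g + g • d f := by
  simp [d, Derivation.leibniz]

lemma d_C (c : ℂ) : d (C c : S ℓ) = 0 := by
  have : algebraMap (S ℓ) (K ℓ) (C c) = algebraMap ℂ (K ℓ) c := by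
    rw [IsScalarTower.algebraMap_apply ℂ (S ℓ) (K ℓ)]; rfl
  rw [d, this, Derivation.map_algebraMap]

lemma ι_smul (f : S ℓ) (v : Ω[K ℓ⁄ℂ]) :
    ExteriorAlgebra.ι (K ℓ) (f • v) = f • ExteriorAlgebra.ι (K ℓ) v := by
  rw [← algebraMap_smul (K ℓ) f v, map_smul, algebraMap_smul]

/-- The `S`-module of regular `1`-forms. -/
def R₁ (ℓ : ℕ) : Submodule (S ℓ) (RatForms ℓ) :=
  Submodule.span (S ℓ) (Set.range fun j : Fin ℓ => δ (X j : S ℓ))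

lemma δ_mem_R₁ (f : S ℓ) : δ f ∈ R₁ ℓ := by
  induction f using MvPolynomial.induction_on with
  | C c => simp [δ, d_C]
  | add p q hp hq => rw [δ, d_add, map_add]; exact add_mem hp hq
  | mul_X p j hp =>
    rw [δ, d_mul, map_add, ι_smul, ι_smul]
    exact add_mem (Submodule.smul_mem _ _ (Submodule.subset_span ⟨j, rfl⟩))
      (Submodule.smul_mem _ _ hp)

lemma span_range_δ : Submodule.span (S ℓ) (Set.range fun f : S ℓ => δ f) = R₁ ℓ := by
  refine le_antisymm (Submodule.span_le.2 ?_) (Submodule.span_mono ?_)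
  · rintro _ ⟨f, rfl⟩
    exact δ_mem_R₁ f
  · rintro _ ⟨j, rfl⟩
    exact ⟨X j, rfl⟩

/-- Turns wedge products of forms into products of submodules, so that later arguments need no
coordinates. -/
lemma regularForms_eq_pow (p : ℕ) : regularForms ℓ p = R₁ ℓ ^ p := by
  induction p with
  | zero =>
    rw [pow_zero, Submodule.one_eq_span, regularForms]
    congr 1
    ext x
    simp [ExteriorAlgebra.ιMulti_zero_apply]
  | succ p ih =>
    rw [pow_succ', ← ih, ← span_range_δ, regularForms, regularForms, Submodule.span_mul_span]
    congr 1
    ext x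
    constructor
    · rintro ⟨f, rfl⟩
      refine ⟨_, ⟨f 0, rfl⟩, _, ⟨fun k => f k.succ, rfl⟩, ?_⟩
      simp [ExteriorAlgebra.ιMulti_succ_apply, Matrix.vecTail, Function.comp_def]
    · rintro ⟨_, ⟨f, rfl⟩, _, ⟨g, rfl⟩, rfl⟩
      refine ⟨Fin.cons f g, ?_⟩
      simp [ExteriorAlgebra.ιMulti_succ_apply, Matrix.vecTail, Function.comp_def]

/-- Contraction of rational forms with a covector. -/
abbrev contr (θ : Module.Dual (K ℓ) (Ω[K ℓ⁄ℂ])) : RatForms ℓ →ₗ[K ℓ] RatForms ℓ :=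
  CliffordAlgebra.contractLeft (Q := (0 : QuadraticForm (K ℓ) (Ω[K ℓ⁄ℂ]))) θ

lemma contr_ι_mul (θ : Module.Dual (K ℓ) (Ω[K ℓ⁄ℂ])) (v : Ω[K ℓ⁄ℂ]) (ω : RatForms ℓ) :
    contr θ (ExteriorAlgebra.ι (K ℓ) v * ω) = θ v • ω - ExteriorAlgebra.ι (K ℓ) v * contr θ ω :=
  CliffordAlgebra.contractLeft_ι_mul _ _ _

lemma contr_smul (θ : Module.Dual (K ℓ) (Ω[K ℓ⁄ℂ])) (f : S ℓ) (ω : RatForms ℓ) :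
    contr θ (f • ω) = f • contr θ ω := by
  rw [← algebraMap_smul (K ℓ) f ω, map_smul, algebraMap_smul]

/-- The coordinate covector `∂/∂x_j`. -/
abbrev θ (j : Fin ℓ) : Module.Dual (K ℓ) (Ω[K ℓ⁄ℂ]) := (dxBasis ℓ).coord j

lemma θ_d_X (j k : Fin ℓ) : θ j (d (X k)) = if k = j then 1 else 0 := by
  rw [← dxBasis_apply, Module.Basis.coord_apply, Module.Basis.repr_self, Finsupp.single_apply]

lemma contr_one_of_mem {ω : RatForms ℓ} (hω : ω ∈ R₁ ℓ ^ 0) (j : Fin ℓ) : contr (θ j) ω = 0 := by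
  rw [pow_zero, Submodule.mem_one] at hω
  obtain ⟨s, rfl⟩ := hω
  rw [Algebra.algebraMap_eq_smul_one, contr_smul, contr, CliffordAlgebra.contractLeft_one,
    smul_zero]

/-- Induction on generators for the powers of a module of `1`-forms. -/
lemma pow_induction (N : Submodule (S ℓ) (RatForms ℓ)) {P : ℕ → RatForms ℓ → Prop}
    (zero : ∀ s : S ℓ, P 0 (algebraMap _ _ s)) (add : ∀ p x y, P p x → P p y → P p (x + y))
    (mul : ∀ p, ∀ x ∈ N, ∀ y ∈ N ^ p, P p y → P (p + 1) (x * y)) :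
    ∀ p, ∀ x ∈ N ^ p, P p x := by
  intro p
  induction p with
  | zero =>
    intro x hx
    obtain ⟨s, rfl⟩ := Submodule.mem_one.1 (by simpa using hx)
    exact zero s
  | succ p ih =>
    intro x hx
    rw [pow_succ'] at hx
    exact Submodule.mul_induction_on hx (fun m hm n hn => mul p m hm n hn (ih n hn)) (add (p + 1))

/-- The antiderivation rule: `s` is the value of `∂/∂x_j` on `x`, a polynomial because `x` is
regular. -/
lemma contr_θ_of_mem_R₁ {x : RatForms ℓ} (hx : x ∈ R₁ ℓ) (j : Fin ℓ) :
    ∃ s : S ℓ, ∀ ω, contr (θ j) (x * ω) = s • ω - x * contr (θ j) ω := by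
  induction hx using Submodule.span_induction with
  | mem x hx =>
    obtain ⟨k, rfl⟩ := hx
    refine ⟨if k = j then 1 else 0, fun ω => ?_⟩
    rw [contr_ι_mul, θ_d_X]
    split_ifs <;> simp
  | zero => exact ⟨0, by simp⟩
  | add x y _ _ hx hy =>
    obtain ⟨s, hs⟩ := hx
    obtain ⟨t, ht⟩ := hy
    refine ⟨s + t, fun ω => ?_⟩
    rw [add_mul, map_add, hs, ht, add_smul, add_mul]
    abel
  | smul c x _ hx =>
    obtain ⟨s, hs⟩ := hx
    refine ⟨c * s, fun ω => ?_⟩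
    rw [smul_mul_assoc, contr_smul, hs, smul_sub, mul_smul, smul_mul_assoc]

lemma contr_mem (j : Fin ℓ) (p : ℕ) {ω : RatForms ℓ} (hω : ω ∈ R₁ ℓ ^ (p + 1)) :
    contr (θ j) ω ∈ R₁ ℓ ^ p := by
  induction p generalizing ω with
  | zero =>
    rw [zero_add, pow_succ'] at hω
    refine Submodule.mul_induction_on hω (fun m hm n hn => ?_) fun x y hx hy => by
      rw [map_add]; exact add_mem hx hy
    obtain ⟨s, hs⟩ := contr_θ_of_mem_R₁ hm j
    rw [hs, contr_one_of_mem hn, mul_zero, sub_zero]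
    exact Submodule.smul_mem _ _ hn
  | succ p ih =>
    rw [pow_succ'] at hω
    refine Submodule.mul_induction_on hω (fun m hm n hn => ?_) fun x y hx hy => by
      rw [map_add]; exact add_mem hx hy
    obtain ⟨s, hs⟩ := contr_θ_of_mem_R₁ hm j
    rw [hs]
    refine sub_mem (Submodule.smul_mem _ _ hn) ?_
    rw [pow_succ']
    exact Submodule.mul_mem_mul hm (ih hn)

/-- Euler's identity: contracting with a coordinate covector and wedging back, summed over the
coordinates, multiplies a `p`-form by `p`. -/
lemma sum_δ_mul_contr (p : ℕ) {ω : RatForms ℓ} (hω : ω ∈ R₁ ℓ ^ p) :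
    ∑ j, δ (X j) * contr (θ j) ω = (p : S ℓ) • ω := by
  have ι_comm : ∀ (u v : Ω[K ℓ⁄ℂ]) (ω : RatForms ℓ),
      ExteriorAlgebra.ι (K ℓ) u * (ExteriorAlgebra.ι (K ℓ) v * ω) =
        - (ExteriorAlgebra.ι (K ℓ) v * (ExteriorAlgebra.ι (K ℓ) u * ω)) := fun u v ω => by
    rw [← mul_assoc, ← mul_assoc, ← neg_mul,
      eq_neg_of_add_eq_zero_left (ExteriorAlgebra.ι_add_mul_swap u v)]
  refine pow_induction (R₁ ℓ) (P := fun p ω => ∑ j, δ (X j) * contr (θ j) ω = (p : S ℓ) • ω)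
    ?_ ?_ ?_ p ω hω
  · intro s
    rw [Nat.cast_zero, zero_smul]
    exact Finset.sum_eq_zero fun j _ => by
      rw [contr_one_of_mem (by rw [pow_zero]; exact Submodule.mem_one.2 ⟨s, rfl⟩), mul_zero]
  · intro p x y hx hy
    simp only [map_add, mul_add, Finset.sum_add_distrib, hx, hy, smul_add]
  · intro p x hx y _ h
    induction hx using Submodule.span_induction with
    | mem x hx =>
      obtain ⟨k, rfl⟩ := hx
      have key : ∀ j, δ (X j) * contr (θ j) (δ (X k) * y) =
          (if k = j then δ (X j) * y else 0) + δ (X k) * (δ (X j) * contr (θ j) y) := fun j => by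
        rw [contr_ι_mul, θ_d_X, mul_sub, ι_comm (d (X j)), sub_neg_eq_add]
        split_ifs <;> simp
      simp only [key, Finset.sum_add_distrib, ← Finset.mul_sum, h, Finset.sum_ite_eq,
        Finset.mem_univ, if_true]
      rw [mul_smul_comm, Nat.cast_add, Nat.cast_one, add_smul, one_smul, add_comm]
    | zero => simp
    | add u v _ _ hu hv =>
      simp only [add_mul, map_add, mul_add, Finset.sum_add_distrib, hu, hv, smul_add]
    | smul c u _ hu =>
      simp only [smul_mul_assoc, contr_smul, mul_smul_comm, ← Finset.smul_sum, hu]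
      rw [smul_comm]

/-! ### Localization at primes and regularity prime by prime. -/

lemma smul_left_cancel {b : S ℓ} (hb : b ≠ 0) {x y : RatForms ℓ} (h : b • x = b • y) : x = y := by
  have hb' : algebraMap (S ℓ) (K ℓ) b ≠ 0 := by simpa using hb
  rw [← algebraMap_smul (K ℓ) b x, ← algebraMap_smul (K ℓ) b y] at h
  exact smul_right_injective _ hb' h

/-- The forms that lie in `N` after localization at the prime `π`. -/
def locAt {π : S ℓ} (hπ : Prime π) (N : Submodule (S ℓ) (RatForms ℓ)) :
    Submodule (S ℓ) (RatForms ℓ) where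
  carrier := {ω | ∃ g, ¬ π ∣ g ∧ g • ω ∈ N}
  zero_mem' := ⟨1, fun h => hπ.not_isUnit (isUnit_of_dvd_one h), by simp⟩
  add_mem' := by
    rintro ω η ⟨g, hg, hω⟩ ⟨g', hg', hη⟩
    refine ⟨g * g', fun h => (hπ.dvd_or_dvd h).elim hg hg', ?_⟩
    rw [smul_add]
    refine add_mem ?_ ?_
    · rw [mul_comm, mul_smul]
      exact Submodule.smul_mem _ _ hω
    · rw [mul_smul]
      exact Submodule.smul_mem _ _ hη
  smul_mem' := by
    rintro c ω ⟨g, hg, hω⟩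
    refine ⟨g, hg, ?_⟩
    rw [smul_comm]
    exact Submodule.smul_mem _ _ hω

section locAt

variable {π : S ℓ} {hπ : Prime π} {N N' : Submodule (S ℓ) (RatForms ℓ)}

lemma mem_locAt {ω : RatForms ℓ} : ω ∈ locAt hπ N ↔ ∃ g, ¬ π ∣ g ∧ g • ω ∈ N := Iff.rfl

lemma le_locAt : N ≤ locAt hπ N := fun ω hω =>
  ⟨1, fun h => hπ.not_isUnit (isUnit_of_dvd_one h), by simpa using hω⟩

lemma locAt_mono (h : N ≤ N') : locAt hπ N ≤ locAt hπ N' := fun _ ⟨g, hg, hω⟩ => ⟨g, hg, h hω⟩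

lemma locAt_of_smul {g : S ℓ} (hg : ¬ π ∣ g) {ω : RatForms ℓ} (h : g • ω ∈ locAt hπ N) :
    ω ∈ locAt hπ N := by
  obtain ⟨g', hg', h⟩ := h
  exact ⟨g' * g, fun h => (hπ.dvd_or_dvd h).elim hg' hg, by rwa [mul_smul]⟩

lemma locAt_mul_le : locAt hπ N * locAt hπ N' ≤ locAt hπ (N * N') := by
  refine Submodule.mul_le.2 ?_
  rintro x ⟨g, hg, hx⟩ y ⟨g', hg', hy⟩
  refine ⟨g * g', fun h => (hπ.dvd_or_dvd h).elim hg hg', ?_⟩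
  rw [← smul_mul_smul_comm]
  exact Submodule.mul_mem_mul hx hy

lemma locAt_pow_le (p : ℕ) : locAt hπ N ^ p ≤ locAt hπ (N ^ p) := by
  induction p with
  | zero => rw [pow_zero, pow_zero]; exact le_locAt
  | succ p ih =>
    rw [pow_succ, pow_succ]
    exact (mul_le_mul' ih le_rfl).trans locAt_mul_le

end locAt

/-- A rational function that is regular at every prime is a polynomial. -/
lemma mem_range_of_forall_prime {z : K ℓ}
    (h : ∀ π : S ℓ, Prime π → ∃ g : S ℓ, ¬ π ∣ g ∧ g • z ∈ (algebraMap (S ℓ) (K ℓ)).range) :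
    z ∈ (algebraMap (S ℓ) (K ℓ)).range := by
  obtain ⟨a, b, hab, rfl⟩ := IsFractionRing.exists_reduced_fraction (A := S ℓ) z
  have hb0 : (b : S ℓ) ≠ 0 := nonZeroDivisors.coe_ne_zero b
  by_cases hb : IsUnit (b : S ℓ)
  · obtain ⟨c, hc⟩ := hb.exists_right_inv
    refine ⟨a * c, ?_⟩
    rw [eq_comm, IsLocalization.mk'_eq_iff_eq_mul, ← map_mul, mul_assoc, mul_comm c, hc, mul_one]
  -- Regularity at a prime factor `π` of the reduced denominator would force `π` to divide the
  -- numerator too.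
  · obtain ⟨π, hπ, hπb⟩ := WfDvdMonoid.exists_irreducible_factor hb hb0
    obtain ⟨g, hg, s, hs⟩ := h π hπ.prime
    have h1 : g * a = s * b := by
      rw [Algebra.smul_def, ← IsLocalization.mk'_one (M := nonZeroDivisors (S ℓ)) (K ℓ) g,
        ← IsLocalization.mk'_mul, one_mul, eq_comm, IsLocalization.mk'_eq_iff_eq_mul,
        ← map_mul] at hs
      exact (IsFractionRing.injective (S ℓ) (K ℓ) hs.symm).symm ▸ rfl
    have h2 : π ∣ g * a := h1 ▸ hπb.mul_left s
    exact absurd (hab ((hπ.prime.dvd_or_dvd h2).resolve_left hg) hπb) hπ.not_isUnit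

/-- A rational `p`-form that is regular at every prime is regular. -/
lemma mem_of_forall_prime (p : ℕ) {ω : RatForms ℓ} {b : S ℓ} (hb : b ≠ 0)
    (hbω : b • ω ∈ R₁ ℓ ^ p) (h : ∀ (π : S ℓ) (hπ : Prime π), ω ∈ locAt hπ (R₁ ℓ ^ p)) :
    ω ∈ R₁ ℓ ^ p := by
  induction p generalizing ω with
  | zero =>
    simp only [pow_zero] at *
    obtain ⟨s, hs⟩ := Submodule.mem_one.1 hbω
    have hb' : algebraMap (S ℓ) (K ℓ) b ≠ 0 := by simpa using hb
    have hinj := ExteriorAlgebra.algebraMap_leftInverse (R := K ℓ) (Ω[K ℓ⁄ℂ])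
    have hω : ω = algebraMap (K ℓ) _ (algebraMap (S ℓ) (K ℓ) s / algebraMap (S ℓ) (K ℓ) b) := by
      apply smul_left_cancel hb
      rw [← hs, ← algebraMap_smul (K ℓ) b (algebraMap (K ℓ) (RatForms ℓ) _), Algebra.smul_def,
        ← map_mul, mul_div_cancel₀ _ hb', ← IsScalarTower.algebraMap_apply]
    generalize algebraMap (S ℓ) (K ℓ) s / algebraMap (S ℓ) (K ℓ) b = z at hω
    have hz : z ∈ (algebraMap (S ℓ) (K ℓ)).range := by
      refine mem_range_of_forall_prime fun π hπ => ?_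
      obtain ⟨g, hg, hgω⟩ := h π hπ
      obtain ⟨t, ht⟩ := Submodule.mem_one.1 hgω
      refine ⟨g, hg, t, hinj.injective ?_⟩
      rw [← IsScalarTower.algebraMap_apply, ht, hω, Algebra.smul_def g z, map_mul,
        ← algebraMap_smul (K ℓ) g (algebraMap (K ℓ) (RatForms ℓ) _), Algebra.smul_def]
    obtain ⟨t, rfl⟩ := hz
    rw [hω, Submodule.mem_one]
    exact ⟨t, IsScalarTower.algebraMap_apply _ _ _ t⟩
  | succ p ih =>
    -- Euler's identity, available for the regular form `b • ω` and then cancelled by `b`, rebuilds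
    -- `(p + 1) • ω` from contractions, which are regular by induction.
    have h1 : ((p + 1 : ℕ) : S ℓ) • ω ∈ R₁ ℓ ^ (p + 1) := by
      have : ((p + 1 : ℕ) : S ℓ) • ω = ∑ j, δ (X j) * contr (θ j) ω := by
        apply smul_left_cancel hb
        rw [smul_comm, ← sum_δ_mul_contr (p + 1) hbω, Finset.smul_sum]
        simp only [contr_smul, mul_smul_comm]
      rw [this]
      refine sum_mem fun j _ => ?_
      rw [pow_succ']
      refine Submodule.mul_mem_mul (δ_mem_R₁ _) (ih (ω := contr (θ j) ω) ?_ fun π hπ => ?_)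
      · rw [← contr_smul]
        exact contr_mem j p hbω
      · obtain ⟨g, hg, hgω⟩ := h π hπ
        refine ⟨g, hg, ?_⟩
        rw [← contr_smul]
        exact contr_mem j p hgω
    -- Characteristic zero: `p + 1` is invertible in `S`.
    have h2 := Submodule.smul_mem (R₁ ℓ ^ (p + 1)) (C ((p + 1 : ℕ) : ℂ)⁻¹) h1
    rwa [← mul_smul, ← map_natCast (C : ℂ →+* S ℓ) (p + 1), ← C_mul,
      inv_mul_cancel₀ (Nat.cast_ne_zero.2 p.succ_ne_zero), C_1, one_smul] at h2

/-! ### Local structure of logarithmic forms along a hyperplane. -/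

namespace Multiarrangement

variable (A : Multiarrangement ℓ) (i : Fin A.n)

/-- The defining linear form `α_i`, as a polynomial. -/
abbrev α : S ℓ := linPoly (A.form i)

lemma prime_α : Prime (A.α i) := prime_linPoly (A.form_ne_zero i)

/-- The part of `Q` prime to the `i`-th hyperplane. -/
def Qcompl : S ℓ := ∏ k ∈ Finset.univ.erase i, A.α k ^ A.mult k

lemma Q_eq : A.Q = A.α i ^ A.mult i * A.Qcompl i :=
  (Finset.mul_prod_erase _ _ (Finset.mem_univ i)).symm

lemma Q_ne_zero : A.Q ≠ 0 :=
  Finset.prod_ne_zero_iff.2 fun i _ => pow_ne_zero _ (A.prime_α i).ne_zero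

end Multiarrangement

lemma exists_smul_of_associated {α β : Module.Dual ℂ (Fin ℓ → ℂ)}
    (h : Associated (linPoly α) (linPoly β)) : ∃ c : ℂ, c ≠ 0 ∧ β = c • α := by
  obtain ⟨u, hu⟩ := h
  obtain ⟨c, hc, huc⟩ := MvPolynomial.isUnit_iff_eq_C_of_isReduced.1 u.isUnit
  refine ⟨c, hc.ne_zero, LinearMap.pi_ext' fun j => LinearMap.ext_ring ?_⟩
  have := congrArg (coeff (Finsupp.single j 1)) hu
  rw [huc, mul_comm, coeff_C_mul, coeff_linPoly, coeff_linPoly] at this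
  simpa using this.symm

namespace Multiarrangement

variable (A : Multiarrangement ℓ) (i : Fin A.n)

lemma not_α_dvd {i k : Fin A.n} (h : i ≠ k) : ¬ A.α i ∣ A.α k := by
  intro hd
  obtain ⟨c, hc, hck⟩ := exists_smul_of_associated
    ((A.prime_α i).associated_of_dvd (A.prime_α k) hd)
  apply h
  apply A.ker_injective
  simp only [hck]
  exact (LinearMap.ker_smul _ c hc).symm

lemma not_dvd_Qcompl : ¬ A.α i ∣ A.Qcompl i := by
  intro h
  obtain ⟨k, hk, hd⟩ := (A.prime_α i).exists_mem_finset_dvd h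
  exact A.not_α_dvd (Finset.ne_of_mem_erase hk).symm ((A.prime_α i).dvd_of_dvd_pow hd)

lemma mem_logForms {p : ℕ} {ω : RatForms ℓ} : ω ∈ A.logForms p ↔ A.Q • ω ∈ R₁ ℓ ^ p ∧
    ∀ i, δ (A.α i) * ω ∈ locAt (A.prime_α i) (R₁ ℓ ^ (p + 1)) := by
  simp only [← regularForms_eq_pow]
  exact Iff.rfl

lemma R₁_pow_le_logForms (p : ℕ) : R₁ ℓ ^ p ≤ A.logForms p := fun ω hω =>
  A.mem_logForms.2 ⟨Submodule.smul_mem _ _ hω, fun i => le_locAt (by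
    rw [pow_succ']; exact Submodule.mul_mem_mul (δ_mem_R₁ _) hω)⟩

lemma R₁_le_logForms : R₁ ℓ ≤ A.logForms 1 := by simpa using A.R₁_pow_le_logForms 1

/-- The logarithmic form `dα_i / α_i ^ m(H_i)`. -/
def u : RatForms ℓ := (algebraMap (S ℓ) (K ℓ) (A.α i ^ A.mult i))⁻¹ • δ (A.α i)

lemma smul_u : A.α i ^ A.mult i • A.u i = δ (A.α i) := by
  have h : algebraMap (S ℓ) (K ℓ) (A.α i ^ A.mult i) ≠ 0 := by
    simpa using fun h => absurd h (A.prime_α i).ne_zero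
  rw [u, ← algebraMap_smul (K ℓ), smul_inv_smul₀ h]

lemma δ_mul_u : δ (A.α i) * A.u i = 0 := by
  rw [u, mul_smul_comm, ExteriorAlgebra.ι_sq_zero, smul_zero]

lemma u_mem_logForms : A.u i ∈ A.logForms 1 := by
  rw [mem_logForms, pow_one]
  refine ⟨?_, fun k => ?_⟩
  · rw [A.Q_eq i, mul_comm, mul_smul, smul_u]
    exact Submodule.smul_mem _ _ (δ_mem_R₁ _)
  · rcases eq_or_ne k i with rfl | hk
    · rw [δ_mul_u]
      exact zero_mem _
    · refine locAt_of_smul (g := A.α i ^ A.mult i)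
        (fun h => A.not_α_dvd hk ((A.prime_α k).dvd_of_dvd_pow h)) (le_locAt ?_)
      rw [← mul_smul_comm, smul_u, pow_two]
      exact Submodule.mul_mem_mul (δ_mem_R₁ _) (δ_mem_R₁ _)

/-- The `1`-forms which generate the logarithmic forms locally at `H_i`. -/
def U : Submodule (S ℓ) (RatForms ℓ) := R₁ ℓ ⊔ Submodule.span (S ℓ) {A.u i}

lemma U_le_logForms : A.U i ≤ A.logForms 1 :=
  sup_le A.R₁_le_logForms (Submodule.span_le.2 (by simpa using A.u_mem_logForms i))

lemma δ_mul_mem_R₁ {x : RatForms ℓ} (hx : x ∈ R₁ ℓ) (f : S ℓ) (y : RatForms ℓ) :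
    δ f * (x * y) = - (x * (δ f * y)) := by
  induction hx using Submodule.span_induction with
  | mem x hx =>
    obtain ⟨k, rfl⟩ := hx
    rw [← mul_assoc, ← mul_assoc, ← neg_mul,
      eq_neg_of_add_eq_zero_left (ExteriorAlgebra.ι_add_mul_swap _ _)]
  | zero => simp
  | add u v _ _ hu hv => rw [add_mul, mul_add, hu, hv, add_mul, neg_add]
  | smul c u _ hu => rw [smul_mul_assoc, mul_smul_comm, hu, smul_mul_assoc, smul_neg]

/-- As `u i ∧ u i = 0`, a product contains `u i` at most once, so a single `α_i ^ m(H_i)` clears the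
pole whatever `p` is. The clauses are proved together: a factor `u i` turns the first into the
second for the remaining factors. -/
lemma of_mem_U_pow (p : ℕ) {ω : RatForms ℓ} (hω : ω ∈ A.U i ^ p) :
    A.α i ^ A.mult i • ω ∈ R₁ ℓ ^ p ∧ δ (A.α i) * ω ∈ R₁ ℓ ^ (p + 1) := by
  refine pow_induction (A.U i) (P := fun p ω => A.α i ^ A.mult i • ω ∈ R₁ ℓ ^ p ∧
    δ (A.α i) * ω ∈ R₁ ℓ ^ (p + 1)) ?_ ?_ ?_ p ω hω
  · intro s
    constructor
    · rw [pow_zero]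
      exact Submodule.smul_mem _ _ (Submodule.mem_one.2 ⟨s, rfl⟩)
    · rw [Algebra.algebraMap_eq_smul_one, mul_smul_comm, mul_one, zero_add, pow_one]
      exact Submodule.smul_mem _ _ (δ_mem_R₁ _)
  · intro p x y hx hy
    rw [smul_add, mul_add]
    exact ⟨add_mem hx.1 hy.1, add_mem hx.2 hy.2⟩
  · rintro p x hx y - ⟨h1, h2⟩
    obtain ⟨r, hr, v, hv, rfl⟩ := Submodule.mem_sup.1 hx
    obtain ⟨s, rfl⟩ := Submodule.mem_span_singleton.1 hv
    rw [add_mul, smul_add, mul_add, smul_mul_assoc, mul_smul_comm, smul_comm,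
      ← smul_mul_assoc _ (A.u i), smul_u, ← mul_assoc _ (A.u i) y, δ_mul_u, zero_mul, smul_zero, add_zero,
      δ_mul_mem_R₁ hr, ← mul_smul_comm]
    refine ⟨add_mem ?_ (Submodule.smul_mem _ _ h2), neg_mem ?_⟩
    · rw [pow_succ']
      exact Submodule.mul_mem_mul hr h1
    · rw [pow_succ']
      exact Submodule.mul_mem_mul hr h2

/-- Koszul homotopy for wedging with `dα_i`; `c` is a nonzero coefficient of `α_i`. It splits a form
into a multiple of `dα_i` and a part controlled by `dα_i ∧ ω`. -/
lemma exists_contr : ∃ (j : Fin ℓ) (c : ℂ), c ≠ 0 ∧ ∀ ω : RatForms ℓ,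
    (C c : S ℓ) • ω = δ (A.α i) * contr (θ j) ω + contr (θ j) (δ (A.α i) * ω) := by
  obtain ⟨j, hj⟩ : ∃ j, A.form i (Pi.single j 1) ≠ 0 := by
    by_contra! h
    exact A.form_ne_zero i (LinearMap.pi_ext' fun j => LinearMap.ext_ring (by simpa using h j))
  refine ⟨j, _, hj, fun ω => ?_⟩
  have h : θ j (d (A.α i)) = algebraMap (S ℓ) (K ℓ) (C (A.form i (Pi.single j 1))) := by
    have : d (A.α i) = ∑ k, (C (A.form i (Pi.single k 1)) : S ℓ) • d (X k) := by
      rw [α, linPoly, d, map_sum, map_sum]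
      exact Finset.sum_congr rfl fun k _ => by
        rw [← d, d_mul, d_C, smul_zero, add_zero]
    rw [this, map_sum, Finset.sum_eq_single j]
    · rw [← algebraMap_smul (K ℓ), map_smul, θ_d_X, if_pos rfl, smul_eq_mul, mul_one]
    · intro k _ hk
      rw [← algebraMap_smul (K ℓ), map_smul, θ_d_X, if_neg hk, smul_zero]
    · simp
  rw [contr_ι_mul, h, algebraMap_smul]
  abel

lemma logForms_le_locAt_U (p : ℕ) : A.logForms p ≤ locAt (A.prime_α i) (A.U i ^ p) := by
  intro ω hω
  obtain ⟨h1, h2⟩ := A.mem_logForms.1 hω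
  have hR : R₁ ℓ ^ p ≤ A.U i ^ p := pow_le_pow_left' le_sup_left p
  obtain ⟨j, c, hc, hω'⟩ := A.exists_contr i
  have hunit : IsUnit (C c : S ℓ) := (isUnit_iff_ne_zero.2 hc).map C
  refine locAt_of_smul (fun h => (A.prime_α i).not_isUnit (isUnit_of_dvd_unit h hunit)) ?_
  rw [hω']
  refine add_mem ?_ ?_
  -- Multiplied by `Qcompl i`, a local unit, this summand becomes `u i` times the contraction of the
  -- regular form `Q • ω`.
  · refine locAt_of_smul (A.not_dvd_Qcompl i) (le_locAt ?_)
    rw [← A.smul_u i, smul_mul_assoc, ← mul_smul, mul_comm, ← A.Q_eq, ← mul_smul_comm,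
      ← contr_smul]
    cases p with
    | zero =>
      rw [contr_one_of_mem h1, mul_zero]
      exact zero_mem _
    | succ p =>
      rw [pow_succ']
      exact Submodule.mul_mem_mul ((le_sup_right : _ ≤ A.U i) (Submodule.mem_span_singleton_self _))
        (pow_le_pow_left' (le_sup_left : _ ≤ A.U i) p (contr_mem j p h1))
  -- Here `dα_i ∧ ω` has no pole, and contraction preserves regularity.
  · obtain ⟨g, hg, h⟩ := h2 i
    refine ⟨g, hg, ?_⟩
    rw [← contr_smul]
    exact hR (contr_mem j p h)

lemma exists_associated_of_dvd_Q {π : S ℓ} (hπ : Prime π) (h : π ∣ A.Q) :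
    ∃ i, Associated π (A.α i) := by
  obtain ⟨i, -, hi⟩ := hπ.exists_mem_finset_dvd h
  exact ⟨i, hπ.associated_of_dvd (A.prime_α i) (hπ.dvd_of_dvd_pow hi)⟩

lemma locAt_congr {π π' : S ℓ} (hπ : Prime π) (hπ' : Prime π') (h : Associated π π')
    (N : Submodule (S ℓ) (RatForms ℓ)) : locAt hπ N = locAt hπ' N := by
  ext ω
  simp only [mem_locAt, h.dvd_iff_dvd_left]

/-- A crude denominator, enough away from `Q` and to start the prime-by-prime test. -/
lemma Q_pow_smul_mem (p : ℕ) {ω : RatForms ℓ} (hω : ω ∈ A.logForms 1 ^ p) :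
    A.Q ^ p • ω ∈ R₁ ℓ ^ p := by
  refine pow_induction (A.logForms 1) (P := fun p ω => A.Q ^ p • ω ∈ R₁ ℓ ^ p) ?_ ?_ ?_ p ω hω
  · intro s
    rw [pow_zero, pow_zero, one_smul]
    exact Submodule.mem_one.2 ⟨s, rfl⟩
  · intro p x y hx hy
    rw [smul_add]
    exact add_mem hx hy
  · intro p x hx y _ h
    rw [pow_succ' A.Q, ← smul_mul_smul_comm, pow_succ']
    exact Submodule.mul_mem_mul (by simpa using (A.mem_logForms.1 hx).1) h

lemma pow_logForms_le_locAt_U (p : ℕ) :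
    A.logForms 1 ^ p ≤ locAt (A.prime_α i) (A.U i ^ p) := by
  refine le_trans (pow_le_pow_left' ?_ p) (locAt_pow_le p)
  simpa using A.logForms_le_locAt_U i 1

/-- The bound `Q` instead of `Q ^ p` is checked at each prime: at `α_i` it is the sharp exponent of
`of_mem_U_pow`, elsewhere `Q ^ p` is a local unit. -/
lemma pow_logForms_le (p : ℕ) : A.logForms 1 ^ p ≤ A.logForms p := by
  intro ω hω
  rw [mem_logForms]
  refine ⟨?_, fun i => ?_⟩
  · refine mem_of_forall_prime p (pow_ne_zero p A.Q_ne_zero) ?_ fun π hπ => ?_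
    · rw [smul_comm]
      exact Submodule.smul_mem _ _ (A.Q_pow_smul_mem p hω)
    · by_cases hd : π ∣ A.Q
      · obtain ⟨i, hi⟩ := A.exists_associated_of_dvd_Q hπ hd
        rw [locAt_congr hπ (A.prime_α i) hi]
        obtain ⟨g, hg, h⟩ := A.pow_logForms_le_locAt_U i p hω
        refine ⟨g, hg, ?_⟩
        rw [A.Q_eq i, mul_comm, mul_smul, smul_comm, smul_comm g]
        exact Submodule.smul_mem _ _ (A.of_mem_U_pow i p h).1
      · refine ⟨A.Q ^ p, fun h => hd (hπ.dvd_of_dvd_pow h), ?_⟩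
        rw [smul_comm]
        exact Submodule.smul_mem _ _ (A.Q_pow_smul_mem p hω)
  · obtain ⟨g, hg, h⟩ := A.pow_logForms_le_locAt_U i p hω
    refine ⟨g, hg, ?_⟩
    rw [← mul_smul_comm]
    exact (A.of_mem_U_pow i p h).2

/-- The logarithmic `p`-forms are the forms that lie, locally at every prime, in the `p`-th power
of the module of logarithmic `1`-forms: `Ω^p(A, m)` is the reflexive hull of `⋀^p Ω^1(A, m)`. -/
lemma mem_logForms_iff (p : ℕ) {ω : RatForms ℓ} : ω ∈ A.logForms p ↔
    (∃ b : S ℓ, b ≠ 0 ∧ b • ω ∈ A.logForms 1 ^ p) ∧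
      ∀ (π : S ℓ) (hπ : Prime π), ω ∈ locAt hπ (A.logForms 1 ^ p) := by
  have hR : R₁ ℓ ^ p ≤ A.logForms 1 ^ p := pow_le_pow_left' A.R₁_le_logForms p
  constructor
  · intro hω
    have h1 := hR (A.mem_logForms.1 hω).1
    refine ⟨⟨A.Q, A.Q_ne_zero, h1⟩, fun π hπ => ?_⟩
    by_cases hd : π ∣ A.Q
    · obtain ⟨i, hi⟩ := A.exists_associated_of_dvd_Q hπ hd
      rw [locAt_congr hπ (A.prime_α i) hi]
      exact locAt_mono (pow_le_pow_left' (A.U_le_logForms i) p)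
        (A.logForms_le_locAt_U i p hω)
    · exact ⟨A.Q, hd, h1⟩
  -- Both defining conditions can be tested at primes, where `ω` becomes a product form covered by
  -- `pow_logForms_le`.
  · rintro ⟨⟨b, hb, hbω⟩, h⟩
    refine A.mem_logForms.2 ⟨mem_of_forall_prime p (mul_ne_zero (pow_ne_zero p A.Q_ne_zero) hb)
      ?_ fun π hπ => ?_, fun i => ?_⟩
    · rw [smul_comm, mul_smul]
      exact Submodule.smul_mem _ _ (A.Q_pow_smul_mem p hbω)
    · obtain ⟨g, hg, hgω⟩ := h π hπ
      refine ⟨g, hg, ?_⟩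
      rw [smul_comm]
      exact (A.mem_logForms.1 (A.pow_logForms_le p hgω)).1
    · obtain ⟨g, hg, hgω⟩ := h _ (A.prime_α i)
      refine locAt_of_smul hg ?_
      rw [← mul_smul_comm]
      exact (A.mem_logForms.1 (A.pow_logForms_le p hgω)).2 i

end Multiarrangement

/-! ### Extending isomorphisms to the algebra of rational forms. -/

lemma map_smul_poly (F : RatForms ℓ →ₐ[K ℓ] RatForms ℓ) (f : S ℓ) (ω : RatForms ℓ) :
    F (f • ω) = f • F ω := by
  rw [← algebraMap_smul (K ℓ) f ω, map_smul, algebraMap_smul]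

lemma map_mem_pow {F : RatForms ℓ →ₐ[K ℓ] RatForms ℓ} {N N' : Submodule (S ℓ) (RatForms ℓ)}
    (h : ∀ ω ∈ N, F ω ∈ N') (p : ℕ) : ∀ ω ∈ N ^ p, F ω ∈ N' ^ p := by
  refine pow_induction N (P := fun p ω => F ω ∈ N' ^ p) ?_ ?_ ?_ p
  · intro s
    rw [Algebra.algebraMap_eq_smul_one, map_smul_poly, map_one, pow_zero]
    exact Submodule.smul_mem _ _ (Submodule.one_le.1 le_rfl)
  · intro p x y hx hy
    rw [map_add]
    exact add_mem hx hy
  · intro p x hx y _ hy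
    rw [map_mul, pow_succ']
    exact Submodule.mul_mem_mul (h x hx) hy

/-- The criterion `mem_logForms_iff` involves only products and polynomial scalars, which `F`
respects. -/
lemma map_mem_logForms {A₁ A₂ : Multiarrangement ℓ} {F : RatForms ℓ →ₐ[K ℓ] RatForms ℓ}
    (h : ∀ ω ∈ A₁.logForms 1, F ω ∈ A₂.logForms 1) (p : ℕ) {ω : RatForms ℓ}
    (hω : ω ∈ A₁.logForms p) : F ω ∈ A₂.logForms p := by
  obtain ⟨⟨b, hb, hbω⟩, hloc⟩ := (A₁.mem_logForms_iff p).1 hω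
  refine (A₂.mem_logForms_iff p).2 ⟨⟨b, hb, ?_⟩, fun π hπ => ?_⟩
  · rw [← map_smul_poly]
    exact map_mem_pow h p _ hbω
  · obtain ⟨g, hg, hgω⟩ := hloc π hπ
    refine ⟨g, hg, ?_⟩
    rw [← map_smul_poly]
    exact map_mem_pow h p _ hgω

/-- The isomorphism on logarithmic `p`-forms induced by an automorphism of the algebra of rational
forms that matches the logarithmic `1`-forms. -/
def logFormsEquiv {A₁ A₂ : Multiarrangement ℓ} (F : RatForms ℓ ≃ₐ[K ℓ] RatForms ℓ)
    (h : ∀ ω ∈ A₁.logForms 1, F ω ∈ A₂.logForms 1)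
    (h' : ∀ ω ∈ A₂.logForms 1, F.symm ω ∈ A₁.logForms 1) (p : ℕ) :
    A₁.logForms p ≃ₗ[S ℓ] A₂.logForms p where
  toFun ω := ⟨F ω, map_mem_logForms (F := F.toAlgHom) h p ω.2⟩
  invFun ω := ⟨F.symm ω, map_mem_logForms (F := F.symm.toAlgHom) h' p ω.2⟩
  map_add' _ _ := Subtype.ext (map_add F _ _)
  map_smul' c _ := Subtype.ext (map_smul_poly F.toAlgHom c _)
  left_inv _ := Subtype.ext (F.symm_apply_apply _)
  right_inv _ := Subtype.ext (F.apply_symm_apply _)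

lemma exists_ι_eq {A : Multiarrangement ℓ} {ω : RatForms ℓ} (hω : ω ∈ A.logForms 1) :
    ∃ v, ExteriorAlgebra.ι (K ℓ) v = ω := by
  have hR : ∀ x ∈ R₁ ℓ, ∃ v, ExteriorAlgebra.ι (K ℓ) v = x := by
    intro x hx
    induction hx using Submodule.span_induction with
    | mem x hx =>
      obtain ⟨k, rfl⟩ := hx
      exact ⟨_, rfl⟩
    | zero => exact ⟨0, map_zero _⟩
    | add x y _ _ hx hy =>
      obtain ⟨v, rfl⟩ := hx
      obtain ⟨w, rfl⟩ := hy
      exact ⟨v + w, map_add _ _ _⟩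
    | smul c x _ hx =>
      obtain ⟨v, rfl⟩ := hx
      exact ⟨c • v, ι_smul _ _⟩
  obtain ⟨v, hv⟩ := hR _ (by simpa using (A.mem_logForms.1 hω).1)
  have hQ : algebraMap (S ℓ) (K ℓ) A.Q ≠ 0 := by simpa using A.Q_ne_zero
  refine ⟨(algebraMap (S ℓ) (K ℓ) A.Q)⁻¹ • v, ?_⟩
  rw [map_smul, hv, ← algebraMap_smul (K ℓ) A.Q ω, inv_smul_smul₀ hQ]

/-- An `S`-linear map between modules of logarithmic `1`-forms extends `K`-linearly. -/
lemma exists_extension {A₁ A₂ : Multiarrangement ℓ} (Ψ : A₁.logForms 1 →ₗ[S ℓ] A₂.logForms 1) :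
    ∃ φ : Ω[K ℓ⁄ℂ] →ₗ[K ℓ] Ω[K ℓ⁄ℂ], ∀ ω : A₁.logForms 1, ExteriorAlgebra.map φ ω = Ψ ω := by
  -- The basis forms `dx_j` are logarithmic, so `Ψ` prescribes their images; other forms are reached
  -- after multiplication by `Q`.
  choose v hv using fun j : Fin ℓ => exists_ι_eq (Ψ ⟨δ (X j), A₁.R₁_le_logForms (δ_mem_R₁ _)⟩).2
  refine ⟨(dxBasis ℓ).constr ℂ v, fun ω => ?_⟩
  set F := ExteriorAlgebra.map ((dxBasis ℓ).constr ℂ v)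
  have hR : ∀ x (hx : x ∈ R₁ ℓ), F x = Ψ ⟨x, A₁.R₁_le_logForms hx⟩ := by
    intro x hx
    induction hx using Submodule.span_induction with
    | mem x hx =>
      obtain ⟨k, rfl⟩ := hx
      rw [← hv k, ExteriorAlgebra.map_apply_ι, ← dxBasis_apply, Module.Basis.constr_basis]
    | zero =>
      rw [map_zero]
      exact (congrArg Subtype.val (map_zero Ψ)).symm
    | add x y hx' hy' hx hy =>
      rw [map_add, hx, hy]
      exact (congrArg Subtype.val (map_add Ψ ⟨x, A₁.R₁_le_logForms hx'⟩
        ⟨y, A₁.R₁_le_logForms hy'⟩)).symm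
    | smul c x hx' hx =>
      rw [map_smul_poly, hx]
      exact (congrArg Subtype.val (map_smul Ψ c ⟨x, A₁.R₁_le_logForms hx'⟩)).symm
  apply smul_left_cancel A₁.Q_ne_zero
  rw [← map_smul_poly, hR _ (by simpa using (A₁.mem_logForms.1 ω.2).1)]
  exact congrArg Subtype.val (map_smul Ψ A₁.Q ω)

lemma hom_eq_id {F : RatForms ℓ →ₐ[K ℓ] RatForms ℓ} (h : ∀ j, F (δ (X j)) = δ (X j)) :
    F = AlgHom.id (K ℓ) (RatForms ℓ) := by
  apply ExteriorAlgebra.hom_ext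
  refine (dxBasis ℓ).ext fun j => ?_
  rw [dxBasis_apply]
  exact h j

/-- An isomorphism between modules of logarithmic `1`-forms extends to an automorphism of the
algebra of rational forms. -/
lemma exists_algEquiv {A₁ A₂ : Multiarrangement ℓ} (Ψ : A₁.logForms 1 ≃ₗ[S ℓ] A₂.logForms 1) :
    ∃ F : RatForms ℓ ≃ₐ[K ℓ] RatForms ℓ, (∀ ω : A₁.logForms 1, F ω = Ψ ω) ∧
      ∀ ω : A₂.logForms 1, F.symm ω = Ψ.symm ω := by
  obtain ⟨φ, hφ⟩ := exists_extension Ψ.toLinearMap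
  obtain ⟨ψ, hψ⟩ := exists_extension Ψ.symm.toLinearMap
  refine ⟨AlgEquiv.ofAlgHom (ExteriorAlgebra.map φ) (ExteriorAlgebra.map ψ)
    (hom_eq_id fun j => ?_) (hom_eq_id fun j => ?_), hφ, hψ⟩
  · have h1 := hψ ⟨δ (X j), A₂.R₁_le_logForms (δ_mem_R₁ _)⟩
    rw [AlgHom.comp_apply]
    simp only at h1
    rw [h1, hφ]
    simp
  · have h1 := hφ ⟨δ (X j), A₁.R₁_le_logForms (δ_mem_R₁ _)⟩
    rw [AlgHom.comp_apply]
    simp only at h1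
    rw [h1, hψ]
    simp

/-! ### The grading. -/

lemma IsHomogeneousRat.mul {e e' : ℤ} {φ ψ : K ℓ} (h : IsHomogeneousRat e φ)
    (h' : IsHomogeneousRat e' ψ) : IsHomogeneousRat (e + e') (φ * ψ) := by
  obtain ⟨r, s, a, b, ha, hb, hb0, rfl, rfl⟩ := h
  obtain ⟨r', s', a', b', ha', hb', hb0', rfl, rfl⟩ := h'
  refine ⟨r + r', s + s', a * a', b * b', ha.mul ha', hb.mul hb', mul_ne_zero hb0 hb0', ?_, ?_⟩
  · push_cast
    ring
  · rw [map_mul, map_mul, div_mul_div_comm]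

lemma isHomogeneousRat_one : IsHomogeneousRat 0 (1 : K ℓ) :=
  ⟨0, 0, 1, 1, isHomogeneous_one _ _, isHomogeneous_one _ _, one_ne_zero, by simp, by simp⟩

lemma mul_mem_homogeneousForms {e : ℤ} {p : ℕ} {x y : RatForms ℓ}
    (hx : x ∈ homogeneousForms ℓ 1 0) (hy : y ∈ homogeneousForms ℓ p e) :
    x * y ∈ homogeneousForms ℓ (p + 1) e := by
  have h := Submodule.mul_mem_mul hx hy
  rw [homogeneousForms, homogeneousForms, Submodule.span_mul_span] at h
  refine Submodule.span_mono ?_ h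
  rintro _ ⟨_, ⟨φ, j, hφ, rfl⟩, _, ⟨ψ, k, hψ, rfl⟩, rfl⟩
  refine ⟨φ * ψ, Fin.cons (j 0) k, by simpa using hφ.mul hψ, ?_⟩
  simp [ExteriorAlgebra.ιMulti_succ_apply, Matrix.vecTail, Function.comp_def, smul_smul, mul_comm]

lemma δ_X_mem_homogeneousForms (j : Fin ℓ) : δ (X j) ∈ homogeneousForms ℓ 1 0 :=
  Submodule.subset_span ⟨1, fun _ => j, isHomogeneousRat_one, by
    simp [ExteriorAlgebra.ιMulti_succ_apply]⟩

/-- By `K`-linearity the coefficient passes through `F`, and each image of a `dx_j` contributes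
degree `0`. -/
lemma map_mem_homogeneousForms {F : RatForms ℓ →ₐ[K ℓ] RatForms ℓ}
    (h : ∀ j, F (δ (X j)) ∈ homogeneousForms ℓ 1 0) (p : ℕ) {e : ℤ} {ω : RatForms ℓ}
    (hω : ω ∈ homogeneousForms ℓ p e) : F ω ∈ homogeneousForms ℓ p e := by
  suffices hs : homogeneousForms ℓ p e ≤
      (homogeneousForms ℓ p e).comap (F.restrictScalars ℂ).toLinearMap from hs hω
  refine Submodule.span_le.2 ?_
  rintro _ ⟨φ, j, hφ, rfl⟩
  change F _ ∈ homogeneousForms ℓ p e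
  clear hω
  induction p with
  | zero =>
    refine Submodule.subset_span ⟨φ, j, hφ, ?_⟩
    rw [map_smul, ExteriorAlgebra.ιMulti_zero_apply, map_one]
  | succ p ih =>
    have := mul_mem_homogeneousForms (h (j 0)) (ih (fun k => j k.succ))
    rw [← map_mul, mul_smul_comm] at this
    rwa [ExteriorAlgebra.ιMulti_succ_apply]

end LogForms

end

theorem mainTheorem6 {ℓ : ℕ} (A₁ A₂ : LogForms.Multiarrangement ℓ) :
    (LogForms.LogFormsGradedIso A₁ A₂ 1 → ∀ p : ℕ, LogForms.LogFormsGradedIso A₁ A₂ p) ∧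
      (LogForms.LogFormsIso A₁ A₂ 1 → ∀ p : ℕ, LogForms.LogFormsIso A₁ A₂ p) := by
  open LogForms in
  constructor
  · rintro ⟨Ψ, hΨ⟩ p
    obtain ⟨F, hF, hF'⟩ := exists_algEquiv Ψ
    refine ⟨logFormsEquiv F (fun ω hω => hF ⟨ω, hω⟩ ▸ (Ψ _).2)
      (fun ω hω => hF' ⟨ω, hω⟩ ▸ (Ψ.symm _).2) p, fun e ω => ⟨fun h => ?_, fun h => ?_⟩⟩
    · refine map_mem_homogeneousForms (F := F.toAlgHom) (fun j => ?_) p h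
      have hj := (hΨ 0 ⟨δ (X j), A₁.R₁_le_logForms (δ_mem_R₁ _)⟩).1 (δ_X_mem_homogeneousForms j)
      rwa [← hF] at hj
    · rw [← F.symm_apply_apply (ω : RatForms ℓ)]
      refine map_mem_homogeneousForms (F := F.symm.toAlgHom) (fun j => ?_) p h
      -- The reverse implication of `hΨ` shows that `F.symm` also sends each `dx_j` to degree `0`.
      have hj := (hΨ 0 (Ψ.symm ⟨δ (X j), A₂.R₁_le_logForms (δ_mem_R₁ _)⟩)).2 (by
        rw [Ψ.apply_symm_apply]
        exact δ_X_mem_homogeneousForms j)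
      rwa [← hF'] at hj
  · rintro ⟨Ψ⟩ p
    obtain ⟨F, hF, hF'⟩ := exists_algEquiv Ψ
    exact ⟨logFormsEquiv F (fun ω hω => hF ⟨ω, hω⟩ ▸ (Ψ _).2)
      (fun ω hω => hF' ⟨ω, hω⟩ ▸ (Ψ.symm _).2) p⟩
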